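/- Let $(W,S)$ be a Coxeter system with $S$ finite ($W$ possibly infinite). Let $\bar S$ be the set of equivalence classes of $S$ under conjugacy in $W$, and let $\Lambda=\mathbb Z[\bar S]$ be the free abelian group with basis $\bar S$. **Cells.** For a totally ordered abelian group $\Gamma$ and a map $\varphi:\bar S\to\Gamma$, let $\mathcal H(W,S,\varphi)$ be the Hecke algebra with parameter $\varphi$: the $\mathbb Z[\Gamma]$-algebra, free over $\mathbb Z[\Gamma]=\bigoplus_\gamma\mathbb Z e^\gamma$ with basis $(T_w)_{w\in W}$, with $T_wT_{w'}=T_{ww'}$ whenever $\ell(ww')=\ell(w)+\ell(w')$ and $(T_s-e^{\varphi(s)})(T_s+e^{-\varphi(s)})=0$ for $s\in S$. Its bar involution is the ring automorphism with $\overline{e^\gamma}=e^{-\gamma}$ and $\overline{T_w}=T_{w^{-1}}^{-1}$, and $(C_w)_{w\in W}$ is its Kazhdan–Lusztig basis: $C_w$ is the unique element with $\overline{C_w}=C_w$ and $C_w\equiv T_w$ modulo $\bigoplus_{x\in W}\bigl(\bigoplus_{\gamma<0}\mathbb Z e^{\gamma}\bigr)T_x$. Write $x\leftarrow_L y$ (resp.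 $x\leftarrow_R y$, resp. $x\leftarrow_{LR}y$) if there is $h\in\mathcal H(W,S,\varphi)$ such that $C_x$ has a non-zero coefficient in the expansion of $hC_y$ (resp. of $C_yh$, resp. of $hC_y$ or of $C_yh$) in the Kazhdan–Lusztig basis. For $?\in\{L,R,LR\}$ let $\leqslant_?^\varphi$ be the transitive closure of $\leftarrow_?$ (a preorder), and $\sim_?^\varphi$ the associated equivalence relation on $W$; its classes are the $?$-cells. **Positive subsets.** A subset $X\subseteq\Lambda$ is positive if $\Lambda=X\cup(-X)$, $X+X\subseteq X$ and $X\cap(-X)$ is a subgroup. Let $\mathcal Pos(\Lambda)$ be the set of positive subsets. For $E\subseteq\Lambda$ put $\mathcal U(E)=\{X\in\mathcal Pos(\Lambda): X\cap E=\varnothing\}$; a subset $\mathcal V$ of $\mathcal Pos(\Lambda)$ is open if for every $X\in\mathcal V$ there is a finite $E\subseteq\Lambda$ with $X\in\mathcal U(E)\subseteq\mathcal V$. For $X\in\mathcal Pos(\Lambda)$ let $\Gamma_X=\Lambda/(X\cap(-X))$, totally ordered by: $\gamma\le\gamma'$ if and only if $\gamma'-\gamma$ has a representative in $X$. Let $\varphi_X:\bar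 S\to\Gamma_X$ be the canonical map, and set $\sim_?^X\,=\,\sim_?^{\varphi_X}$ and $\mathrm{Cell}_?^X(w)=\{x\in W: x\sim_?^X w\}$. **Arrangements.** For $\lambda\in\Lambda\setminus\{0\}$, the rational hyperplane $\mathcal H_\lambda$ is $\{X\in\mathcal Pos(\Lambda):\lambda\in X\cap(-X)\}$. The space $\mathcal Pos(\Lambda)$ is the disjoint union of $\mathcal U(\{\lambda\})$, $\mathcal H_\lambda$ and $\mathcal U(\{-\lambda\})$, and this partition depends only on the hyperplane. For a finite set $\mathfrak A$ of rational hyperplanes, the $\mathfrak A$-facets are the classes of the equivalence relation "for every hyperplane in $\mathfrak A$, $X$ and $Y$ lie in the same part of this partition"; the $\mathfrak A$-chambers are the facets that meet no member of $\mathfrak A$. The arrangement $\mathfrak A$ is complete if $\mathcal H_\omega\in\mathfrak A$ for all $\omega\in\bar S$. For a facet $\mathcal F$, let $W_{\mathcal F}$ be the subgroup of $W$ generated by the $s\in S$ whose class $\omega$ satisfies $\mathcal F\subseteq\mathcal H_\omega$. **Conjecture A for $(W,S)$.** There is a finite complete rational hyperplane arrangement $\mathfrak A$ in $\mathcal Pos(\Lambda)$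 such that, for all $?\in\{L,R,LR\}$: (a) if $X$ and $Y$ belong to the same $\mathfrak A$-facet $\mathcal F$, then $\sim_?^X\,=\,\sim_?^Y$ (denote this relation by $\sim_?^{\mathcal F}$); (b) for every $\mathfrak A$-facet $\mathcal F$, the classes of $\sim_?^{\mathcal F}$ are the minimal non-empty subsets $C$ of $W$ such that (b1) for every chamber $\mathcal C$ with $\mathcal F\subseteq\overline{\mathcal C}$, $C$ is a union of classes of $\sim_?^{\mathcal C}$, and (b2) $C$ is stable under translation by $W_{\mathcal F}$ (on the left if $?=L$, on the right if $?=R$, on both sides if $?=LR$). A map $\xi$ from a topological space $\mathcal X$ to a partially ordered set $P$ is called upper semicontinuous if $\{x\in\mathcal X:\xi(x)<p\}$ is open for every $p\in P$. **Theorem.** Suppose that Conjecture A holds for $(W,S)$. Then: 1. for every $?\in\{L,R,LR\}$, the map $X\mapsto\,\sim_?^X$ from $\mathcal Pos(\mathbb Z[\bar S])$ to the lattice of equivalence relations on $W$, ordered by $\mathcal R\preccurlyeq\mathcal R'$ if and only if $x\,\mathcal R\,y$ implies $x\,\mathcal R'\,y$, is upper semicontinuous; 2. for every $?\in\{L,R,LR\}$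 and every $w\in W$, the map $X\mapsto\mathrm{Cell}_?^X(w)$ from $\mathcal Pos(\mathbb Z[\bar S])$ to the power set of $W$, ordered by inclusion, is upper semicontinuous. -/

import Mathlib

open Set Topology

noncomputable section

namespace KLCells

/-! ## Positive subsets of an abelian group -/

section Positive

/-- A subset `X` of an abelian group with `Λ = X ∪ (-X)`, `X + X ⊆ X`, and such that
`X ∩ (-X)` is a subgroup. -/
@[ext]
structure PositiveSubset (Λ : Type*) [AddCommGroup Λ] where
  carrier : Set Λ
  union_neg : ∀ a : Λ, a ∈ carrier ∨ -a ∈ carrier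
  add_mem : ∀ a ∈ carrier, ∀ b ∈ carrier, a + b ∈ carrier
  inter_neg : ∃ H : AddSubgroup Λ, (H : Set Λ) = {a | a ∈ carrier ∧ -a ∈ carrier}

variable {Λ : Type*} [AddCommGroup Λ]

/-- `U E` is the set of positive subsets that are disjoint from `E`. -/
def U (E : Set Λ) : Set (PositiveSubset Λ) := {X | X.carrier ∩ E = ∅}

theorem U_union (E F : Set Λ) : U (E ∪ F) = U E ∩ U F := by
  ext X
  simp only [U, mem_ofPred_eq, mem_inter_iff, inter_union_distrib_left, union_empty_iff]

/-- A set `V` of positive subsets is open if every `X ∈ V` has a finite `E ⊆ Λ` with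
`X ∈ U E ⊆ V`. -/
instance : TopologicalSpace (PositiveSubset Λ) where
  IsOpen V := ∀ X ∈ V, ∃ E : Set Λ, E.Finite ∧ X ∈ U E ∧ U E ⊆ V
  isOpen_univ := fun X _ => ⟨∅, finite_empty, by simp [U], subset_univ _⟩
  isOpen_inter := by
    rintro V V' hV hV' X ⟨hX, hX'⟩
    obtain ⟨E, hE, hXE, hEV⟩ := hV X hX
    obtain ⟨F, hF, hXF, hFV⟩ := hV' X hX'
    refine ⟨E ∪ F, hE.union hF, ?_, ?_⟩
    · rw [U_union]; exact ⟨hXE, hXF⟩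
    · rw [U_union]; exact inter_subset_inter hEV hFV
  isOpen_sUnion := by
    rintro 𝒱 h𝒱 X ⟨V, hV, hXV⟩
    obtain ⟨E, hE, hXE, hEV⟩ := h𝒱 V hV X hXV
    exact ⟨E, hE, hXE, hEV.trans (subset_sUnion_of_mem hV)⟩

/-- The rational hyperplane attached to `a` (meant for `a ≠ 0`): the set of positive subsets
`X` with `a ∈ X ∩ (-X)`. -/
def hyperplane (a : Λ) : Set (PositiveSubset Λ) := {X | a ∈ X.carrier ∧ -a ∈ X.carrier}

/-- A rational hyperplane arrangement: a set of rational hyperplanes. -/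
def IsArrangement (𝔄 : Set (Set (PositiveSubset Λ))) : Prop :=
  ∀ P ∈ 𝔄, ∃ a : Λ, a ≠ 0 ∧ P = hyperplane a

/-- The relation defined by a rational hyperplane `P = hyperplane a`: its classes are `U {a}`,
`P` and `U {-a}`. They do not depend on the choice of `a`, so all choices are taken at once. -/
def SameSide (P : Set (PositiveSubset Λ)) (X Y : PositiveSubset Λ) : Prop :=
  ∀ a : Λ, a ≠ 0 → P = hyperplane a →
    (X ∈ U {a} ↔ Y ∈ U {a}) ∧ (X ∈ P ↔ Y ∈ P) ∧ (X ∈ U {-a} ↔ Y ∈ U {-a})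

/-- `X` and `Y` are on the same side of every hyperplane of the arrangement. -/
def facetSetoid (𝔄 : Set (Set (PositiveSubset Λ))) : Setoid (PositiveSubset Λ) where
  r X Y := ∀ P ∈ 𝔄, SameSide P X Y
  iseqv :=
    { refl := fun _ _ _ _ _ _ => ⟨Iff.rfl, Iff.rfl, Iff.rfl⟩
      symm := fun h P hP a ha hPa =>
        ⟨(h P hP a ha hPa).1.symm, (h P hP a ha hPa).2.1.symm, (h P hP a ha hPa).2.2.symm⟩
      trans := fun h h' P hP a ha hPa =>
        ⟨(h P hP a ha hPa).1.trans (h' P hP a ha hPa).1,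
          (h P hP a ha hPa).2.1.trans (h' P hP a ha hPa).2.1,
          (h P hP a ha hPa).2.2.trans (h' P hP a ha hPa).2.2⟩ }

/-- Facets are the equivalence classes of `facetSetoid 𝔄`. -/
def IsFacet (𝔄 : Set (Set (PositiveSubset Λ))) (F : Set (PositiveSubset Λ)) : Prop :=
  F ∈ (facetSetoid 𝔄).classes

/-- Chambers are the facets that meet no hyperplane of the arrangement. -/
def IsChamber (𝔄 : Set (Set (PositiveSubset Λ))) (C : Set (PositiveSubset Λ)) : Prop :=
  IsFacet 𝔄 C ∧ ∀ P ∈ 𝔄, C ∩ P = ∅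

namespace PositiveSubset

variable (X : PositiveSubset Λ)

theorem zero_mem : (0 : Λ) ∈ X.carrier := by
  rcases X.union_neg 0 with h | h <;> simpa using h

/-- The subgroup `X ∩ (-X)`. -/
def ker : AddSubgroup Λ where
  carrier := {a | a ∈ X.carrier ∧ -a ∈ X.carrier}
  add_mem' := by
    rintro a b ⟨ha, ha'⟩ ⟨hb, hb'⟩
    refine ⟨X.add_mem a ha b hb, ?_⟩
    rw [neg_add]
    exact X.add_mem _ ha' _ hb'
  zero_mem' := ⟨X.zero_mem, by simpa using X.zero_mem⟩
  neg_mem' := by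
    rintro a ⟨ha, ha'⟩
    exact ⟨ha', by simpa using ha⟩

/-- The quotient group `Γ_X = Λ / (X ∩ (-X))`. -/
def Gam : Type _ := Λ ⧸ X.ker

instance : AddCommGroup X.Gam := inferInstanceAs (AddCommGroup (Λ ⧸ X.ker))

/-- The canonical morphism `Λ → Γ_X`. -/
def can : Λ →+ X.Gam := QuotientAddGroup.mk' X.ker

theorem can_surjective : Function.Surjective X.can := QuotientAddGroup.mk'_surjective X.ker

theorem can_eq_iff {a b : Λ} : X.can a = X.can b ↔ b - a ∈ X.ker := by
  have h : X.can a = X.can b ↔ -a + b ∈ X.ker := QuotientAddGroup.eq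
  rw [h, neg_add_eq_sub]

/-- `γ ≤ δ` if some representative of `δ - γ` belongs to `X`. -/
instance : LE X.Gam := ⟨fun γ δ => ∃ a ∈ X.carrier, X.can a = δ - γ⟩

theorem gam_le_def {γ δ : X.Gam} : γ ≤ δ ↔ ∃ a ∈ X.carrier, X.can a = δ - γ := Iff.rfl

theorem can_le_can {a b : Λ} : X.can a ≤ X.can b ↔ b - a ∈ X.carrier := by
  rw [gam_le_def]
  constructor
  · rintro ⟨c, hc, h⟩
    rw [← map_sub, can_eq_iff] at h
    have := X.add_mem _ h.1 _ hc
    simpa using this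
  · intro h
    exact ⟨b - a, h, map_sub _ _ _⟩

instance : LinearOrder X.Gam where
  le_refl γ := ⟨0, X.zero_mem, by simp⟩
  le_trans γ δ ε h h' := by
    obtain ⟨a, rfl⟩ := X.can_surjective γ
    obtain ⟨b, rfl⟩ := X.can_surjective δ
    obtain ⟨c, rfl⟩ := X.can_surjective ε
    rw [can_le_can] at *
    simpa using X.add_mem _ h' _ h
  le_antisymm γ δ h h' := by
    obtain ⟨a, rfl⟩ := X.can_surjective γ
    obtain ⟨b, rfl⟩ := X.can_surjective δ
    rw [can_le_can] at *
    rw [can_eq_iff]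
    exact ⟨h, by simpa using h'⟩
  le_total γ δ := by
    obtain ⟨a, rfl⟩ := X.can_surjective γ
    obtain ⟨b, rfl⟩ := X.can_surjective δ
    simp only [can_le_can]
    simpa using X.union_neg (b - a)
  toDecidableLE := Classical.decRel _

instance : IsOrderedAddMonoid X.Gam where
  add_le_add_left γ δ h ε := by
    obtain ⟨a, rfl⟩ := X.can_surjective γ
    obtain ⟨b, rfl⟩ := X.can_surjective δ
    obtain ⟨c, rfl⟩ := X.can_surjective ε
    rw [← map_add, ← map_add]
    rw [can_le_can] at *
    simpa using h

end PositiveSubset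

end Positive

/-! ## Hecke algebras with unequal parameters -/

section Hecke

variable {B W : Type*} [Group W] {M : CoxeterMatrix B} (cs : CoxeterSystem M W)

/-- Conjugacy in `W` of simple reflections. -/
def conjSetoid : Setoid B := (IsConj.setoid W).comap cs.simple

/-- The set of `W`-conjugacy classes of simple reflections. -/
def SBar : Type _ := Quotient (conjSetoid cs)

/-- The class of a simple reflection. -/
def cls (i : B) : SBar cs := Quotient.mk (conjSetoid cs) i

instance [Finite B] : Finite (SBar cs) := inferInstanceAs (Finite (Quotient _))

variable {Γ : Type*} [AddCommGroup Γ]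

/-- The group algebra `ℤ[Γ]`. -/
abbrev Coef (Γ : Type*) [AddCommGroup Γ] : Type _ := AddMonoidAlgebra ℤ Γ

/-- The element `e^γ` of `ℤ[Γ]`. -/
def ex (γ : Γ) : Coef Γ := AddMonoidAlgebra.single γ 1

theorem ex_add (γ δ : Γ) : ex (γ + δ) = ex γ * ex δ := by
  simp [ex, AddMonoidAlgebra.single_mul_single]

theorem ex_zero : ex (0 : Γ) = 1 := rfl

/-- The involution of `ℤ[Γ]` sending `e^γ` to `e^(-γ)`. -/
def barCoef : Coef Γ →+* Coef Γ := AddMonoidAlgebra.mapDomainRingHom ℤ (negAddMonoidHom : Γ →+ Γ)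

theorem barCoef_ex (γ : Γ) : barCoef (ex γ) = ex (-γ) := by
  simp [barCoef, ex]

variable (φ : SBar cs → Γ)

/-- The defining relations of the Hecke algebra with parameter `φ`, on generators indexed
by `W`. -/
inductive HeckeRel : FreeAlgebra (Coef Γ) W → FreeAlgebra (Coef Γ) W → Prop
  | one : HeckeRel (FreeAlgebra.ι (Coef Γ) 1) 1
  | mul (w w' : W) (h : cs.length (w * w') = cs.length w + cs.length w') :
      HeckeRel (FreeAlgebra.ι (Coef Γ) w * FreeAlgebra.ι (Coef Γ) w')
        (FreeAlgebra.ι (Coef Γ) (w * w'))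
  | quad (i : B) :
      HeckeRel
        ((FreeAlgebra.ι (Coef Γ) (cs.simple i) - algebraMap (Coef Γ) _ (ex (φ (cls cs i)))) *
          (FreeAlgebra.ι (Coef Γ) (cs.simple i) + algebraMap (Coef Γ) _ (ex (-φ (cls cs i))))) 0

/-- The Hecke algebra with parameter `φ`: the unital `ℤ[Γ]`-algebra generated by the `T_w`,
subject to `T_1 = 1`, to `T_w T_w' = T_{ww'}` if the lengths add up, and to
`(T_s - e^φ(s)) (T_s + e^(-φ(s))) = 0`. It is free over `ℤ[Γ]` with basis `(T_w)`. -/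
def Hecke : Type _ := RingQuot (HeckeRel cs φ)

instance : Ring (Hecke cs φ) := inferInstanceAs (Ring (RingQuot (HeckeRel cs φ)))

instance : Algebra (Coef Γ) (Hecke cs φ) :=
  inferInstanceAs (Algebra (Coef Γ) (RingQuot (HeckeRel cs φ)))

/-- The projection from the free algebra. -/
def proj : FreeAlgebra (Coef Γ) W →ₐ[Coef Γ] Hecke cs φ :=
  RingQuot.mkAlgHom (Coef Γ) (HeckeRel cs φ)

/-- The standard basis element `T_w`. -/
def T (w : W) : Hecke cs φ := proj cs φ (FreeAlgebra.ι (Coef Γ) w)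

/-- The image of `e^γ` in the Hecke algebra. -/
def exH (γ : Γ) : Hecke cs φ := algebraMap (Coef Γ) (Hecke cs φ) (ex γ)

theorem proj_rel {a b : FreeAlgebra (Coef Γ) W} (h : HeckeRel cs φ a b) :
    proj cs φ a = proj cs φ b := RingQuot.mkAlgHom_rel (Coef Γ) h

theorem T_one : T cs φ 1 = 1 := by
  have := proj_rel cs φ HeckeRel.one
  rwa [map_one] at this

theorem T_mul (w w' : W) (h : cs.length (w * w') = cs.length w + cs.length w') :
    T cs φ w * T cs φ w' = T cs φ (w * w') := by
  have := proj_rel cs φ (HeckeRel.mul w w' h)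
  rwa [map_mul] at this

theorem T_quad (i : B) :
    (T cs φ (cs.simple i) - exH cs φ (φ (cls cs i))) *
      (T cs φ (cs.simple i) + exH cs φ (-φ (cls cs i))) = 0 := by
  have := proj_rel cs φ (HeckeRel.quad i)
  rwa [map_mul, map_sub, map_add, map_zero, AlgHom.commutes, AlgHom.commutes] at this

theorem exH_mul_neg (γ : Γ) : exH cs φ γ * exH cs φ (-γ) = 1 := by
  rw [exH, exH, ← map_mul, ← ex_add, add_neg_cancel, ex_zero, map_one]

theorem exH_commute (γ : Γ) (h : Hecke cs φ) : exH cs φ γ * h = h * exH cs φ γ :=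
  Algebra.commutes _ _

theorem T_simple_mul (i : B) :
    T cs φ (cs.simple i) *
      (T cs φ (cs.simple i) - exH cs φ (φ (cls cs i)) + exH cs φ (-φ (cls cs i))) = 1 := by
  have h := T_quad cs φ i
  have h1 := exH_mul_neg cs φ (φ (cls cs i))
  have h2 := exH_commute cs φ (φ (cls cs i)) (T cs φ (cs.simple i))
  rw [sub_mul, mul_add, mul_add, h1, h2] at h
  rw [mul_add, mul_sub]
  rw [← sub_eq_zero, ← h]
  abel

theorem T_simple_mul_left (i : B) :
    (T cs φ (cs.simple i) - exH cs φ (φ (cls cs i)) + exH cs φ (-φ (cls cs i))) *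
      T cs φ (cs.simple i) = 1 := by
  rw [← T_simple_mul cs φ i, add_mul, sub_mul, mul_add, mul_sub, exH_commute, exH_commute]

theorem isUnit_T_simple (i : B) : IsUnit (T cs φ (cs.simple i)) :=
  ⟨⟨_, _, T_simple_mul cs φ i, T_simple_mul_left cs φ i⟩, rfl⟩

theorem isUnit_T (w : W) : IsUnit (T cs φ w) := by
  induction hn : cs.length w generalizing w with
  | zero =>
    rw [cs.length_eq_zero_iff] at hn
    rw [hn, T_one]
    exact isUnit_one
  | succ n ih =>
    have hw : w ≠ 1 := by
      rintro rfl
      simp at hn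
    obtain ⟨i, hi⟩ := cs.exists_leftDescent_of_ne_one hw
    rw [cs.isLeftDescent_iff] at hi
    have h1 : cs.length (cs.simple i * w) = n := by omega
    have h2 := T_mul cs φ (cs.simple i) (cs.simple i * w) (by
      rw [cs.simple_mul_simple_cancel_left, cs.length_simple]
      omega)
    rw [cs.simple_mul_simple_cancel_left] at h2
    rw [← h2]
    exact (isUnit_T_simple cs φ i).mul (ih _ h1)

/-- The inverse of `T_w`. -/
def Tinv (w : W) : Hecke cs φ := ↑((isUnit_T cs φ w).unit⁻¹)

theorem Tinv_mul (w : W) : Tinv cs φ w * T cs φ w = 1 := (isUnit_T cs φ w).val_inv_mul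

theorem mul_Tinv (w : W) : T cs φ w * Tinv cs φ w = 1 := (isUnit_T cs φ w).mul_val_inv

theorem Tinv_eq {w : W} {h : Hecke cs φ} (hh : T cs φ w * h = 1) : Tinv cs φ w = h :=
  left_inv_eq_right_inv (Tinv_mul cs φ w) hh

/-- The ring `Hecke cs φ`, as an algebra over `ℤ[Γ]` through `e^γ ↦ e^(-γ)`. -/
def Twist : Type _ := Hecke cs φ

instance : Ring (Twist cs φ) := inferInstanceAs (Ring (Hecke cs φ))

instance : Algebra (Coef Γ) (Twist cs φ) :=
  RingHom.toAlgebra' (S := Twist cs φ) ((algebraMap (Coef Γ) (Hecke cs φ)).comp barCoef)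
    fun r h => Algebra.commutes (A := Hecke cs φ) (barCoef r) h

/-- The antilinear ring morphism on the free algebra sending the generator `w` to the inverse of
`T_{w⁻¹}`. -/
def barFree : FreeAlgebra (Coef Γ) W →+* Hecke cs φ :=
  (FreeAlgebra.lift (Coef Γ) (A := Twist cs φ) fun w => Tinv cs φ w⁻¹).toRingHom

theorem barFree_ι (w : W) : barFree cs φ (FreeAlgebra.ι (Coef Γ) w) = Tinv cs φ w⁻¹ :=
  FreeAlgebra.lift_ι_apply (A := Twist cs φ) _ w

theorem barFree_algebraMap (r : Coef Γ) :
    barFree cs φ (algebraMap (Coef Γ) _ r) = algebraMap (Coef Γ) (Hecke cs φ) (barCoef r) :=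
  (FreeAlgebra.lift (Coef Γ) (A := Twist cs φ) fun w => Tinv cs φ w⁻¹).commutes r

theorem barFree_rel ⦃a b : FreeAlgebra (Coef Γ) W⦄ (h : HeckeRel cs φ a b) :
    barFree cs φ a = barFree cs φ b := by
  induction h with
  | one =>
    rw [barFree_ι, map_one]
    exact Tinv_eq cs φ (by rw [inv_one, T_one, one_mul])
  | mul w w' h =>
    rw [map_mul, barFree_ι, barFree_ι, barFree_ι]
    symm
    apply Tinv_eq
    have h1 : cs.length (w'⁻¹ * w⁻¹) = cs.length w'⁻¹ + cs.length w⁻¹ := by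
      rw [← mul_inv_rev, cs.length_inv, cs.length_inv, cs.length_inv, h, add_comm]
    rw [mul_inv_rev, ← T_mul cs φ _ _ h1, mul_assoc, ← mul_assoc (T cs φ w⁻¹), mul_Tinv, one_mul,
      mul_Tinv]
  | quad i =>
    rw [map_mul, map_sub, map_add, map_zero, barFree_ι, barFree_algebraMap, barFree_algebraMap,
      barCoef_ex, barCoef_ex, neg_neg, cs.inv_simple, Tinv_eq cs φ (T_simple_mul cs φ i)]
    change (T cs φ (cs.simple i) - exH cs φ (φ (cls cs i)) + exH cs φ (-φ (cls cs i))
        - exH cs φ (-φ (cls cs i))) *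
      (T cs φ (cs.simple i) - exH cs φ (φ (cls cs i)) + exH cs φ (-φ (cls cs i))
        + exH cs φ (φ (cls cs i))) = 0
    rw [← T_quad cs φ i]
    congr 1 <;> abel

/-- The bar involution: the antilinear ring endomorphism of the Hecke algebra sending `T_w` to
the inverse of `T_{w⁻¹}`. -/
def bar : Hecke cs φ →+* Hecke cs φ := RingQuot.lift ⟨barFree cs φ, barFree_rel cs φ⟩

theorem bar_proj (a : FreeAlgebra (Coef Γ) W) : bar cs φ (proj cs φ a) = barFree cs φ a := by
  have h : proj cs φ a = RingQuot.mkRingHom (HeckeRel cs φ) a := by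
    rw [proj, ← RingQuot.mkAlgHom_coe (Coef Γ)]
    rfl
  rw [h]
  exact RingQuot.lift_mkRingHom_apply (barFree cs φ) (barFree_rel cs φ) a

theorem bar_T (w : W) : bar cs φ (T cs φ w) = Tinv cs φ w⁻¹ := by
  rw [T, bar_proj, barFree_ι]

theorem bar_exH (γ : Γ) : bar cs φ (exH cs φ γ) = exH cs φ (-γ) := by
  rw [exH, ← AlgHom.commutes (proj cs φ), bar_proj, barFree_algebraMap, barCoef_ex]
  rfl

end Hecke

/-! ## Kazhdan-Lusztig basis and cells -/

section Cells

/-- The three kinds of cells: left, right, two-sided. -/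
inductive Side
  | L | R | LR

variable {B W : Type*} [Group W] {M : CoxeterMatrix B} (cs : CoxeterSystem M W)
variable {Γ : Type*} [AddCommGroup Γ] [LinearOrder Γ] [IsOrderedAddMonoid Γ] (φ : SBar cs → Γ)

/-- The additive subgroup `⨁_w ℤ[Γ_{<0}] T_w`. -/
def heckeNeg : AddSubgroup (Hecke cs φ) :=
  AddSubgroup.closure {h | ∃ γ : Γ, γ < 0 ∧ ∃ w : W, h = ex γ • T cs φ w}

/-- `C` is bar-invariant and congruent to `T_w` modulo `⨁_w ℤ[Γ_{<0}] T_w`. -/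
def IsKL (w : W) (C : Hecke cs φ) : Prop := bar cs φ C = C ∧ C - T cs φ w ∈ heckeNeg cs φ

/-- The Kazhdan-Lusztig basis element `C_w`: the element, unique by a theorem of Lusztig, that
satisfies `IsKL`. -/
def klC (w : W) : Hecke cs φ := Classical.epsilon (IsKL cs φ w)

/-- `C_x` has a non-zero coefficient in the decomposition of `h` in the Kazhdan-Lusztig basis. -/
def Occurs (x : W) (h : Hecke cs φ) : Prop :=
  ∃ c : W →₀ Coef Γ, Finsupp.linearCombination (Coef Γ) (klC cs φ) c = h ∧ c x ≠ 0

/-- The relation `x ← y` that generates the Kazhdan-Lusztig preorder. -/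
def Arrow (q : Side) (x y : W) : Prop :=
  match q with
  | .L => ∃ h : Hecke cs φ, Occurs cs φ x (h * klC cs φ y)
  | .R => ∃ h : Hecke cs φ, Occurs cs φ x (klC cs φ y * h)
  | .LR => ∃ h : Hecke cs φ, Occurs cs φ x (h * klC cs φ y) ∨ Occurs cs φ x (klC cs φ y * h)

/-- The Kazhdan-Lusztig preorder. Since `x ← x` (take `h = 1`), the transitive closure of `←` is
also its reflexive transitive closure. -/
def KLle (q : Side) : W → W → Prop := Relation.ReflTransGen (Arrow cs φ q)

/-- The equivalence relation whose classes are the cells. -/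
def sim (q : Side) : Setoid W where
  r x y := KLle cs φ q x y ∧ KLle cs φ q y x
  iseqv :=
    { refl := fun _ => ⟨.refl, .refl⟩
      symm := fun h => ⟨h.2, h.1⟩
      trans := fun h h' => ⟨h.1.trans h'.1, h'.2.trans h.2⟩ }

/-- The cell of `w`. -/
def Cell (q : Side) (w : W) : Set W := {x | sim cs φ q x w}

/-- The free abelian group on the set of classes of simple reflections. -/
abbrev Lat : Type _ := SBar cs →₀ ℤ

/-- The canonical map from classes of simple reflections to `Γ_X`. -/
def phiX (X : PositiveSubset (Lat cs)) : SBar cs → X.Gam :=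
  fun ω => X.can (Finsupp.single ω 1)

/-- The equivalence relation attached to a positive subset `X`. -/
def simX (q : Side) (X : PositiveSubset (Lat cs)) : Setoid W := sim cs (phiX cs X) q

/-- The cell of `w` attached to a positive subset `X`. -/
def CellX (q : Side) (w : W) (X : PositiveSubset (Lat cs)) : Set W := Cell cs (phiX cs X) q w

/-! ## The conjecture -/

/-- The rational hyperplane attached to a class of simple reflections. -/
def hypCls (ω : SBar cs) : Set (PositiveSubset (Lat cs)) := hyperplane (Finsupp.single ω 1)

/-- The standard parabolic subgroup `W_F`. -/
def parabolic (F : Set (PositiveSubset (Lat cs))) : Subgroup W :=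
  Subgroup.closure {s | ∃ i : B, s = cs.simple i ∧ F ⊆ hypCls cs (cls cs i)}

/-- `C` is stable under translation by `H`: on the left, on the right, or on both sides. -/
def StableUnder (q : Side) (H : Subgroup W) (C : Set W) : Prop :=
  match q with
  | .L => ∀ u ∈ H, ∀ x ∈ C, u * x ∈ C
  | .R => ∀ u ∈ H, ∀ x ∈ C, x * u ∈ C
  | .LR => ∀ u ∈ H, ∀ x ∈ C, u * x ∈ C ∧ x * u ∈ C

/-- `C` is a union of equivalence classes of `r`. -/
def IsUnionOfClasses (r : Setoid W) (C : Set W) : Prop := ∃ 𝒟 ⊆ r.classes, C = ⋃₀ 𝒟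

/-- `C` is a union of cells for every chamber whose closure contains the facet `F` (the relation of
a chamber is that of any of its elements), and is stable under translation by `W_F`. -/
def CellCondition (𝔄 : Set (Set (PositiveSubset (Lat cs)))) (q : Side)
    (F : Set (PositiveSubset (Lat cs))) (C : Set W) : Prop :=
  (∀ D : Set (PositiveSubset (Lat cs)), IsChamber 𝔄 D → F ⊆ closure D →
    ∀ Y ∈ D, IsUnionOfClasses (simX cs q Y) C) ∧
  StableUnder q (parabolic cs F) C

/-- Conjecture A for `(W, S)`, `S` being finite: there is a finite complete rational hyperplane
arrangement such that the equivalence relation of `X` depends only on the facet of `X`, and such that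
the cells for a facet are the minimal non-empty subsets that satisfy `CellCondition`. -/
def ConjectureA : Prop :=
  ∃ 𝔄 : Set (Set (PositiveSubset (Lat cs))),
    𝔄.Finite ∧ IsArrangement 𝔄 ∧ (∀ ω : SBar cs, hypCls cs ω ∈ 𝔄) ∧
    ∀ q : Side,
      (∀ F, IsFacet 𝔄 F → ∀ X ∈ F, ∀ Y ∈ F, simX cs q X = simX cs q Y) ∧
      (∀ F, IsFacet 𝔄 F → ∀ X ∈ F, ∀ C : Set W,
        C ∈ (simX cs q X).classes ↔
          Minimal (fun C' : Set W => C'.Nonempty ∧ CellCondition cs 𝔄 q F C') C)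

end Cells

end KLCells

end

namespace KLCells

/-! ### Topology of the space of positive subsets, and closures of facets. -/

section Positive

variable {Λ : Type*} [AddCommGroup Λ]

/-! Both semicontinuity statements follow once the cell relation of every `Y` near `X` refines that
of `X` (`ConjectureA.eventually_simX_le`). Let `F` and `F'` be the facets of `X` and `Y`. For `Y`
close to `X`, each hyperplane avoiding `X` has `Y` strictly on the same side
(`eventually_mem_U_of_arrangement`), and this forces `F ⊆ closure F'` (`IsFacet.subset_closure`).
Then fewer chambers are adjacent to `F'` than to `F`, and the parabolic subgroup of `F'` is smaller,
so the cell condition for `F` implies the one for `F'` (`CellCondition.of_subset_closure`). Hence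
the `X`-cell of a point, intersected with its `Y`-cell, still satisfies the condition for `F'`;
minimality of the `Y`-cell puts it inside the `X`-cell. -/

theorem mem_U_singleton {a : Λ} {X : PositiveSubset Λ} : X ∈ U {a} ↔ a ∉ X.carrier := by
  simp [U]

theorem isOpen_U {E : Set Λ} (hE : E.Finite) : IsOpen (U E) :=
  fun _ hX => ⟨E, hE, hX, subset_rfl⟩

/-- The topology is not Hausdorff in general: every neighbourhood of `X` contains all positive
subsets included in `X`. Closures of facets are computed through this. -/
theorem U_anti {X Y : PositiveSubset Λ} (h : Y.carrier ⊆ X.carrier) {E : Set Λ} (hX : X ∈ U E) :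
    Y ∈ U E :=
  subset_empty_iff.1 ((inter_subset_inter_left E h).trans (subset_of_eq hX))

theorem isClosed_hyperplane (a : Λ) : IsClosed (hyperplane a) := by
  have h : hyperplane a = (U {a})ᶜ ∩ (U {-a})ᶜ := by
    ext X
    simp only [mem_inter_iff, mem_compl_iff, mem_U_singleton, not_not]
    rfl
  rw [h]
  exact (isOpen_U (finite_singleton a)).isClosed_compl.inter
    (isOpen_U (finite_singleton (-a))).isClosed_compl

namespace PositiveSubset

/-- Build a positive subset from closure under addition; the third axiom is automatic. -/
def ofAddMem (X : Set Λ) (h : ∀ a, a ∈ X ∨ -a ∈ X) (h' : ∀ a ∈ X, ∀ b ∈ X, a + b ∈ X) :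
    PositiveSubset Λ where
  carrier := X
  union_neg := h
  add_mem := h'
  inter_neg := by
    have h0 : (0 : Λ) ∈ X := by simpa using h 0
    refine ⟨{ carrier := {a | a ∈ X ∧ -a ∈ X}, add_mem' := ?_, zero_mem' := ?_, neg_mem' := ?_ },
      rfl⟩
    · rintro a b ⟨ha, ha'⟩ ⟨hb, hb'⟩
      exact ⟨h' a ha b hb, by simpa only [neg_add] using h' _ ha' _ hb'⟩
    · exact ⟨h0, by simpa using h0⟩
    · rintro a ⟨ha, ha'⟩
      exact ⟨ha', by simpa using ha⟩

/-- The elements on which an additive functional is nonnegative. -/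
def ofFunctional (f : Λ →+ ℚ) : PositiveSubset Λ :=
  ofAddMem {a | 0 ≤ f a}
    (fun a => by
      simp only [mem_ofPred_eq, map_neg, Left.nonneg_neg_iff]
      exact le_total _ _)
    (fun a ha b hb => by
      simp only [mem_ofPred_eq, map_add] at *
      exact add_nonneg ha hb)

theorem mem_hyperplane_ofFunctional {f : Λ →+ ℚ} {a : Λ} :
    ofFunctional f ∈ hyperplane a ↔ f a = 0 := by
  change 0 ≤ f a ∧ 0 ≤ f (-a) ↔ _
  rw [map_neg, Left.nonneg_neg_iff, le_antisymm_iff, and_comm]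

/-- The lexicographic refinement of `Y` by `X`: the elements that are strictly positive for `Y`,
or belong to its kernel and are positive for `X`. -/
def lex (Y X : PositiveSubset Λ) : PositiveSubset Λ :=
  ofAddMem {a | a ∈ Y.carrier ∧ (-a ∈ Y.carrier → a ∈ X.carrier)}
    (fun a => by
      have h1 := Y.union_neg a
      have h2 := X.union_neg a
      simp only [mem_ofPred_eq, neg_neg]
      tauto)
    (fun a ⟨ha, ha'⟩ b ⟨hb, hb'⟩ => by
      -- If `-(a + b) ∈ Y`, adding `b` or `a` shows that both summands lie in the kernel of `Y`.
      refine ⟨Y.add_mem a ha b hb, fun h => X.add_mem a (ha' ?_) b (hb' ?_)⟩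
      · simpa using Y.add_mem _ h _ hb
      · simpa using Y.add_mem _ h _ ha)

theorem mem_lex {X Y : PositiveSubset Λ} {a : Λ} :
    a ∈ (lex Y X).carrier ↔ a ∈ Y.carrier ∧ (-a ∈ Y.carrier → a ∈ X.carrier) := Iff.rfl

variable (X : PositiveSubset Λ)

theorem nsmul_mem {a : Λ} (ha : a ∈ X.carrier) (n : ℕ) : n • a ∈ X.carrier := by
  induction n with
  | zero => simpa using X.zero_mem
  | succ n ih => simpa only [succ_nsmul] using X.add_mem _ ih _ ha

theorem nsmul_mem_iff {a : Λ} {n : ℕ} (hn : n ≠ 0) : n • a ∈ X.carrier ↔ a ∈ X.carrier := by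
  refine ⟨fun h => ?_, fun h => X.nsmul_mem h n⟩
  obtain ⟨m, rfl⟩ := Nat.exists_eq_succ_of_ne_zero hn
  rcases X.union_neg a with ha | ha
  · exact ha
  -- Here `a = (m + 1) • a + m • (-a)`.
  · simpa [succ_nsmul] using X.add_mem _ h _ (X.nsmul_mem ha m)

end PositiveSubset

theorem U_singleton_nsmul (a : Λ) {n : ℕ} (hn : n ≠ 0) :
    (U {n • a} : Set (PositiveSubset Λ)) = U {a} := by
  ext X
  rw [mem_U_singleton, mem_U_singleton, X.nsmul_mem_iff hn]

/-- Two elements of a free abelian group with the same rational hyperplane are proportional. -/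
theorem exists_nsmul_eq_zsmul_of_hyperplane_eq {σ : Type*} {a b : σ →₀ ℤ} (hb : b ≠ 0)
    (h : hyperplane a = hyperplane b) : ∃ (m : ℕ) (n : ℤ), m ≠ 0 ∧ n ≠ 0 ∧ m • b = n • a := by
  let ι : (σ →₀ ℤ) →+ (σ →₀ ℚ) := Finsupp.mapRange.addMonoidHom (Int.castAddHom ℚ)
  have hι : Function.Injective ι :=
    Finsupp.mapRange_injective (Int.castAddHom ℚ) (map_zero _) Int.cast_injective
  have hspan : ι b ∈ Submodule.span ℚ {ι a} := by
    -- Otherwise a rational functional kills `a` but not `b`; the positive subset it defines lies on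
    -- the hyperplane of `a` and off that of `b`.
    by_contra hnot
    obtain ⟨f, hf, hle⟩ := Submodule.exists_le_ker_of_notMem hnot
    have ha : PositiveSubset.ofFunctional (f.toAddMonoidHom.comp ι) ∈ hyperplane a :=
      PositiveSubset.mem_hyperplane_ofFunctional.2 (hle (Submodule.mem_span_singleton_self _))
    rw [h, PositiveSubset.mem_hyperplane_ofFunctional] at ha
    exact hf ha
  obtain ⟨q, hq⟩ := Submodule.mem_span_singleton.1 hspan
  have hq0 : q ≠ 0 := by
    rintro rfl
    rw [zero_smul] at hq
    exact hb (hι (hq.symm.trans (map_zero ι).symm))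
  -- Clear denominators in `b = q • a`.
  refine ⟨q.den, q.num, q.den_ne_zero, Rat.num_ne_zero.2 hq0, hι ?_⟩
  rw [map_nsmul, map_zsmul, ← hq, ← Nat.cast_smul_eq_nsmul ℚ, ← Int.cast_smul_eq_zsmul ℚ, smul_smul,
    mul_comm, Rat.mul_den_eq_num]

/-- A hyperplane has infinitely many normal vectors, but they are proportional, and a positive
multiple does not change the open side; only the sign of the ratio matters. So one normal vector per
hyperplane suffices to control its sides. -/
theorem U_singleton_of_hyperplane_eq {σ : Type*} {a b : σ →₀ ℤ} (hb : b ≠ 0)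
    (h : hyperplane a = hyperplane b) :
    (U {b} : Set (PositiveSubset (σ →₀ ℤ))) = U {a} ∨
      (U {b} : Set (PositiveSubset (σ →₀ ℤ))) = U {-a} := by
  obtain ⟨m, n, hm, hn, hmn⟩ := exists_nsmul_eq_zsmul_of_hyperplane_eq hb h
  rw [← U_singleton_nsmul b hm, hmn]
  have hn' : n.natAbs ≠ 0 := Int.natAbs_ne_zero.2 hn
  rcases Int.natAbs_eq n with h' | h'
  · left
    rw [← U_singleton_nsmul a hn', h', natCast_zsmul, Int.natAbs_natCast]
  · right
    rw [← U_singleton_nsmul (-a) hn', h', neg_smul, natCast_zsmul, smul_neg, Int.natAbs_neg,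
      Int.natAbs_natCast]

/-- Every `Y` close to `X` lies strictly on the same side as `X` of each member of a finite
arrangement that avoids `X`. -/
theorem eventually_mem_U_of_arrangement {σ : Type*} {𝔄 : Set (Set (PositiveSubset (σ →₀ ℤ)))}
    (h𝔄 : 𝔄.Finite) (X : PositiveSubset (σ →₀ ℤ)) :
    ∀ᶠ Y in 𝓝 X, ∀ a ≠ 0, hyperplane a ∈ 𝔄 → X ∈ U {a} → Y ∈ U {a} := by
  have key (c : σ →₀ ℤ) : ∀ᶠ Y in 𝓝 X, X ∈ U {c} → Y ∈ U {c} := by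
    by_cases hc : X ∈ U {c}
    · filter_upwards [(isOpen_U (finite_singleton c)).mem_nhds hc] with Y hY _ using hY
    · exact .of_forall fun Y h => absurd h hc
  have h : ∀ᶠ Y in 𝓝 X, ∀ P ∈ 𝔄, ∀ a ≠ 0, hyperplane a = P → X ∈ U {a} → Y ∈ U {a} := by
    rw [Filter.eventually_all_finite h𝔄]
    intro P _
    by_cases hP : ∃ a : σ →₀ ℤ, hyperplane a = P
    · obtain ⟨a, rfl⟩ := hP
      -- One fixed normal vector `a` and its opposite give a single neighbourhood that serves every
      -- other normal vector `b`.
      filter_upwards [key a, key (-a)] with Y h1 h2 b hb hba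
      rcases U_singleton_of_hyperplane_eq hb hba.symm with h | h <;> rwa [h]
    · exact .of_forall fun Y a _ ha => absurd ⟨a, ha⟩ hP
  filter_upwards [h] with Y hY a ha hP using hY _ hP a ha rfl

/-- A facet `F` lies in the closure of a facet `F'` as soon as some `X' ∈ F'` lies strictly on the
same side as some `X ∈ F` of each hyperplane that avoids `X`. -/
theorem IsFacet.subset_closure {𝔄 : Set (Set (PositiveSubset Λ))} {F F' : Set (PositiveSubset Λ)}
    (hF : IsFacet 𝔄 F) (hF' : IsFacet 𝔄 F') {X X' : PositiveSubset Λ} (hX : X ∈ F) (hX' : X' ∈ F')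
    (h : ∀ a ≠ 0, hyperplane a ∈ 𝔄 → X ∈ U {a} → X' ∈ U {a}) : F ⊆ closure F' := by
  intro Y hY
  rw [mem_closure_iff]
  intro V hV hYV
  obtain ⟨E, -, hYE, hEV⟩ := hV Y hYV
  -- The refinement of `Y` by `X'` is included in `Y`, hence lies in every neighbourhood of `Y`; it
  -- remains to see that it belongs to `F'`.
  refine ⟨Y.lex X', hEV (U_anti (fun _ ha => (PositiveSubset.mem_lex.1 ha).1) hYE), ?_⟩
  obtain ⟨X₀, rfl⟩ := hF
  obtain ⟨X₁, rfl⟩ := hF'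
  have hYX : (facetSetoid 𝔄).r Y X := (facetSetoid 𝔄).trans' hY ((facetSetoid 𝔄).symm' hX)
  have hside (a : Λ) (ha : a ≠ 0) (hP : hyperplane a ∈ 𝔄) :
      (a ∉ Y.carrier → a ∉ X'.carrier) ∧ (-a ∉ Y.carrier → -a ∉ X'.carrier) := by
    have hneg : hyperplane (-a) = hyperplane a := by
      ext Z
      simp only [hyperplane, neg_neg, mem_ofPred_eq, and_comm]
    have hs := hYX _ hP a ha rfl
    simp only [← mem_U_singleton]
    exact ⟨fun hm => h a ha hP (hs.1.1 hm),
      fun hm => h (-a) (neg_ne_zero.2 ha) (hneg ▸ hP) (hs.2.2.1 hm)⟩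
  -- On a hyperplane containing `Y` the refinement is decided by `X'`; off it, `Y` decides, and
  -- `hside` says that `X'` agrees.
  refine (facetSetoid 𝔄).trans' (y := X') ?_ hX'
  rintro P hP a ha rfl
  obtain ⟨h1, h2⟩ := hside a ha hP
  have u1 := Y.union_neg a
  have u2 := X'.union_neg a
  simp only [mem_U_singleton, PositiveSubset.mem_lex, hyperplane, mem_ofPred_eq, neg_neg]
  tauto

theorem mem_facet (𝔄 : Set (Set (PositiveSubset Λ))) (X : PositiveSubset Λ) :
    ∃ F, IsFacet 𝔄 F ∧ X ∈ F :=
  ⟨_, Setoid.mem_classes _ X, (facetSetoid 𝔄).refl' X⟩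

end Positive

/-! ### Cell conditions along closures of facets, and semicontinuity. -/

section Cells

theorem isUnionOfClasses_iff {W : Type*} {r : Setoid W} {C : Set W} :
    IsUnionOfClasses r C ↔ ∀ x ∈ C, ∀ y, r y x → y ∈ C := by
  constructor
  · rintro ⟨𝒟, h𝒟, rfl⟩ x ⟨D, hD, hx⟩ y hyx
    obtain ⟨z, rfl⟩ := h𝒟 hD
    exact ⟨_, hD, r.trans' hyx hx⟩
  · intro h
    refine ⟨{D | D ∈ r.classes ∧ D ⊆ C}, fun D hD => hD.1, subset_antisymm ?_ ?_⟩
    · intro x hx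
      exact ⟨_, ⟨r.mem_classes x, fun y hy => h x hx y hy⟩, r.refl' x⟩
    · exact sUnion_subset fun D hD => hD.2

theorem IsUnionOfClasses.inter {W : Type*} {r : Setoid W} {C D : Set W}
    (hC : IsUnionOfClasses r C) (hD : IsUnionOfClasses r D) : IsUnionOfClasses r (C ∩ D) := by
  rw [isUnionOfClasses_iff] at *
  exact fun x hx y hy => ⟨hC x hx.1 y hy, hD x hx.2 y hy⟩

theorem StableUnder.mono {W : Type*} [Group W] {q : Side} {H K : Subgroup W} {C : Set W}
    (h : StableUnder q K C) (hHK : H ≤ K) : StableUnder q H C := by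
  cases q <;> exact fun u hu => h u (hHK hu)

theorem StableUnder.inter {W : Type*} [Group W] {q : Side} {H : Subgroup W} {C D : Set W}
    (hC : StableUnder q H C) (hD : StableUnder q H D) : StableUnder q H (C ∩ D) := by
  cases q
  · exact fun u hu x hx => ⟨hC u hu x hx.1, hD u hu x hx.2⟩
  · exact fun u hu x hx => ⟨hC u hu x hx.1, hD u hu x hx.2⟩
  · exact fun u hu x hx => ⟨⟨(hC u hu x hx.1).1, (hD u hu x hx.2).1⟩,
      (hC u hu x hx.1).2, (hD u hu x hx.2).2⟩

variable {B W : Type*} [Group W] {M : CoxeterMatrix B} (cs : CoxeterSystem M W)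

/-- Hyperplanes are closed, so one that contains `F'` also contains `F`. -/
theorem parabolic_anti {F F' : Set (PositiveSubset (Lat cs))} (h : F ⊆ closure F') :
    parabolic cs F' ≤ parabolic cs F := by
  apply Subgroup.closure_mono
  rintro s ⟨i, rfl, hi⟩
  exact ⟨i, rfl, h.trans (closure_minimal hi (isClosed_hyperplane _))⟩

variable {cs} {𝔄 : Set (Set (PositiveSubset (Lat cs)))} {q : Side}
  {F F' : Set (PositiveSubset (Lat cs))} {C C' : Set W}

/-- A chamber with `F'` in its closure has `F` there too, so both requirements weaken on passing
from `F` to `F'`. -/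
theorem CellCondition.of_subset_closure (hC : CellCondition cs 𝔄 q F C) (h : F ⊆ closure F') :
    CellCondition cs 𝔄 q F' C :=
  ⟨fun D hD hF' => hC.1 D hD (h.trans (closure_minimal hF' isClosed_closure)),
    hC.2.mono (parabolic_anti cs h)⟩

theorem CellCondition.inter (hC : CellCondition cs 𝔄 q F C) (hC' : CellCondition cs 𝔄 q F C') :
    CellCondition cs 𝔄 q F (C ∩ C') :=
  ⟨fun D hD hF Y hY => (hC.1 D hD hF Y hY).inter (hC'.1 D hD hF Y hY), hC.2.inter hC'.2⟩

/-- Under Conjecture A, the relation of `Y` refines the relation of `X` for all `Y` near `X`. -/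
theorem ConjectureA.eventually_simX_le (hA : ConjectureA cs) (q : Side)
    (X : PositiveSubset (Lat cs)) : ∀ᶠ Y in 𝓝 X, simX cs q Y ≤ simX cs q X := by
  obtain ⟨𝔄, hfin, -, -, h⟩ := hA
  obtain ⟨-, hcells⟩ := h q
  obtain ⟨F, hF, hXF⟩ := mem_facet 𝔄 X
  filter_upwards [eventually_mem_U_of_arrangement hfin X] with Y hY
  obtain ⟨F', hF', hYF'⟩ := mem_facet 𝔄 Y
  have hcl := hF.subset_closure hF' hXF hYF' hY
  intro x y hxy
  -- Only the cell condition is needed for the `X`-cell; minimality is used for the `Y`-cell.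
  have hC := ((hcells F hF X hXF _).1 ((simX cs q X).mem_classes y)).prop
  have hC' := (hcells F' hF' Y hYF' _).1 ((simX cs q Y).mem_classes y)
  have hinter : {x | simX cs q Y x y} ⊆ {x | simX cs q X x y} ∩ {x | simX cs q Y x y} :=
    hC'.le_of_le
      ⟨⟨y, (simX cs q X).refl' y, (simX cs q Y).refl' y⟩,
        (hC.2.of_subset_closure hcl).inter hC'.prop.2⟩ inter_subset_right
  exact (hinter hxy).1

end Cells

end KLCells

theorem mainTheorem9 {B W : Type*} [Finite B] [Group W] {M : CoxeterMatrix B}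
    (cs : CoxeterSystem M W) (hA : KLCells.ConjectureA cs) :
    (∀ q : KLCells.Side, UpperSemicontinuous
      (fun X : KLCells.PositiveSubset (KLCells.Lat cs) => KLCells.simX cs q X)) ∧
    (∀ (q : KLCells.Side) (w : W), UpperSemicontinuous
      (fun X : KLCells.PositiveSubset (KLCells.Lat cs) => KLCells.CellX cs q w X)) := by
  refine ⟨fun q X R hR => ?_, fun q w X R hR => ?_⟩
  -- The values near `X` are at most the value at `X`, hence stay below any strict upper bound `R`.
  · filter_upwards [hA.eventually_simX_le q X] with Y hY using hY.trans_lt hR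
  · filter_upwards [hA.eventually_simX_le q X] with Y hY
    exact lt_of_le_of_lt (fun x hx => hY hx) hR
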